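/- Let $\eta$ be a positive equivalence relation, that is, a recursively enumerable equivalence relation on $\mathbb N$ with infinitely many equivalence classes. Let $a_0<a_1<a_2<\cdots$ be the numbers that are least in their $\eta$-class, let $A_n=\{x:\exists m<n\;[x\,\eta\,a_m]\}$, and let $\mathcal A_\eta=\{A_n:n\in\mathbb N\}$ be the ascending family for $\eta$. An $\eta$-family is a class of sets, each a union of $\eta$-classes, that has a one-one uniformly r.e. numbering $B_0,B_1,\ldots$ A text for a set $L\subseteq\mathbb N$ is a map $T:\mathbb N\to\mathbb N\cup\{\#\}$ with $\operatorname{range}(T)\setminus\{\#\}=L$; $T[n]$ is the sequence $T(0),\ldots,T(n-1)$, and $\operatorname{cnt}(T[n])$ is the set of numbers that occur in it. A learner is a recursive function $M:(\mathbb N\cup\{\#\})^*\to\mathbb N\cup\{?\}$. A learner $M$ conservatively explanatorily learns a class $\mathcal C$ with respect to a hypothesis space $H_0,H_1,\ldots$ if for every $L\in\mathcal C$ and every text $T$ for $L$, 1. there is an $n$ with $M(T[n])\in\mathbb N$, $H_{M(T[n])}=L$ and $M(T[j])=M(T[n])$ for all $j\ge n$; and 2. for all $n\in\mathbb N$ and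 $k\ge 1$ with $M(T[n])\in\mathbb N$, if $M(T[n])\ne M(T[n+k])$ then $\operatorname{cnt}(T[n+k])\not\subseteq H_{M(T[n])}$. $\mathcal C$ is conservatively explanatorily learnable if some learner does this with respect to the standard numbering $W_0,W_1,\ldots$ of all r.e. sets. It is class-preservingly conservatively explanatorily learnable if some learner does this with respect to some uniformly r.e. hypothesis space $H_0,H_1,\ldots$ with $\{H_i:i\in\mathbb N\}=\mathcal C$. **Theorem.** For every positive equivalence relation $\eta$ there is an $\eta$-family $\mathcal C\subseteq\mathcal A_\eta$ that is conservatively explanatorily learnable but not class-preservingly conservatively explanatorily learnable. Moreover, $\mathcal C$ can be taken of the form $\{A_{f(n)+1}:n\in\mathbb N\}$, where $f:\mathbb N\to\mathbb N$ is strictly increasing, is the pointwise limit of a uniformly recursive approximation that is non-decreasing in the stage, and dominates every recursive function $g$ (that is, $g(n)\le f(n)$ for all but finitely many $n$). -/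

import Mathlib

namespace EtaLearn

/-- A positive equivalence relation on `ℕ`: recursively enumerable, with infinitely many
equivalence classes. -/
def IsPositive (η : Setoid ℕ) : Prop :=
  REPred (fun p : ℕ × ℕ => η p.1 p.2) ∧ Infinite (Quotient η)

/-- `a_n`: the `n`-th (in increasing order, starting with `n = 0`) number that is the least element
of its `η`-equivalence class. -/
noncomputable def leastRep (η : Setoid ℕ) (n : ℕ) : ℕ :=
  Nat.nth (fun x => ∀ y, η x y → x ≤ y) n

/-- `A_n = [a_0, …, a_{n-1}]`. -/
def ascendingSet (η : Setoid ℕ) (n : ℕ) : Set ℕ :=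
  {x | ∃ m < n, η x (leastRep η m)}

/-- The ascending family `{A_n : n ∈ ℕ}` of `η`. -/
def ascendingFamily (η : Setoid ℕ) : Set (Set ℕ) :=
  Set.range (ascendingSet η)

/-- The set `L` is a union of `η`-equivalence classes. -/
def IsEtaClosed (η : Setoid ℕ) (L : Set ℕ) : Prop :=
  ∀ x ∈ L, ∀ y, η x y → y ∈ L

/-- The numbering `H_0, H_1, …` of sets is uniformly recursively enumerable. -/
def UniformlyRE (H : ℕ → Set ℕ) : Prop :=
  REPred (fun p : ℕ × ℕ => p.2 ∈ H p.1)

/-- An `η`-family: a class of `η`-closed sets with a one-one uniformly r.e. numbering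
`B_0, B_1, …` (in particular, the class is infinite). -/
def IsEtaFamily (η : Setoid ℕ) (C : Set (Set ℕ)) : Prop :=
  (∀ L ∈ C, IsEtaClosed η L) ∧
    ∃ B : ℕ → Set ℕ, UniformlyRE B ∧ Function.Injective B ∧ Set.range B = C

/-- `W_e`: the domain of the `e`-th partial recursive function. -/
def W (e : ℕ) : Set ℕ :=
  {x | ((Denumerable.ofNat Nat.Partrec.Code e).eval x).Dom}

/-- `T` is a text for `L`; the pause symbol `#` is `none`. -/
def IsText (T : ℕ → Option ℕ) (L : Set ℕ) : Prop :=
  {x | ∃ i, T i = some x} = L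

/-- The initial segment `T[n] = T(0), …, T(n-1)`. -/
def initSeg (T : ℕ → Option ℕ) (n : ℕ) : List (Option ℕ) :=
  (List.range n).map T

/-- The content of a finite sequence: the numbers (not `#`) which occur in it. -/
def content (σ : List (Option ℕ)) : Set ℕ :=
  {x | some x ∈ σ}

/-- A learner, as a map from finite sequences to conjectures; the symbol `?` is `none`. Learners
are required to be computable wherever they are quantified over. -/
abbrev Learner := List (Option ℕ) → Option ℕ

/-- `M` explanatorily learns `C` with respect to the hypothesis space `H_0, H_1, …`. -/
def ExLearns (H : ℕ → Set ℕ) (M : Learner) (C : Set (Set ℕ)) : Prop :=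
  ∀ L ∈ C, ∀ T, IsText T L →
    ∃ n e, M (initSeg T n) = some e ∧ H e = L ∧
      ∀ j ≥ n, M (initSeg T j) = M (initSeg T n)

/-- On texts for members of `C`, the learner `M` gives up a conjecture `e` only if the set `H_e`
does not contain all the data seen so far. Replacing `?` is not a change of conjecture. -/
def IsConservative (H : ℕ → Set ℕ) (M : Learner) (C : Set (Set ℕ)) : Prop :=
  ∀ L ∈ C, ∀ T, IsText T L → ∀ n k e, 1 ≤ k → M (initSeg T n) = some e →
    M (initSeg T n) ≠ M (initSeg T (n + k)) → ¬ content (initSeg T (n + k)) ⊆ H e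

/-- `C` has a recursive conservative explanatory learner with respect to the hypothesis space
`H_0, H_1, …`. -/
def ConsExLearnableWrt (H : ℕ → Set ℕ) (C : Set (Set ℕ)) : Prop :=
  ∃ M : Learner, Computable M ∧ ExLearns H M C ∧ IsConservative H M C

/-- `C` is conservatively explanatorily learnable: the conjectures are indices in the numbering
`W_0, W_1, …` of all r.e. sets. -/
def ConsExLearnable (C : Set (Set ℕ)) : Prop :=
  ConsExLearnableWrt W C

/-- `C` is class-preservingly conservatively explanatorily learnable: this is possible with respect
to some uniformly r.e. hypothesis space that consists exactly of the members of `C`. -/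
def ClassPreservingConsExLearnable (C : Set (Set ℕ)) : Prop :=
  ∃ H : ℕ → Set ℕ, UniformlyRE H ∧ Set.range H = C ∧ ConsExLearnableWrt H C

/-- `f` is the pointwise limit of a recursive approximation from below. -/
def LimitFromBelow (f : ℕ → ℕ) : Prop :=
  ∃ F : ℕ → ℕ → ℕ, Computable₂ F ∧ (∀ n, Monotone (F n)) ∧
    ∀ n, ∃ s₀, ∀ s ≥ s₀, F n s = f n

/-- `f` dominates every recursive function: it is eventually at least as large. -/
def DominatesRecursive (f : ℕ → ℕ) : Prop :=
  ∀ g : ℕ → ℕ, Computable g → ∃ n₀, ∀ n ≥ n₀, g n ≤ f n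

end EtaLearn

/-!
Let `f` dominate every recursive function, and let `C` consist of the sets `B_n = A_{f n + 1}`. As
`a_m ≥ m`, the set `B_n` contains all numbers up to `f n`.

A class-preserving conservative learner would compute a function that exceeds `f`. Starting from
the empty sequence, search repeatedly for an extension on which the learner gives up a conjecture
that contained the data so far. Because the conjecture is some `B_k`, each such mind change produces
data that leave one more `B_i`, so after `n + 1` of them some number above `f n` has appeared.

A learner that may leave the class is not subject to this: the whole ascending family is learned
by conjecturing `H_b`, the numbers equivalent to something below `b`, for the first `b` that is not
refuted by the data. If `b` is least in its class, then `H_b` is in the family, and the occurrence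
of `b` refutes it. Otherwise the enumeration of `H_b` is cut off when `b` turns out to be equivalent
to a smaller number; what remains is finitely decidable, so its inconsistency with the data is too.
-/

namespace EtaLearn

open Filter
open Nat.Partrec (Code)

/-! ### Recursively enumerable relations -/

theorem exists_forall_mem_list_iff {β : Type*} {Q : ℕ → β → Prop} (hQ : Monotone Q) (l : List β) :
    (∃ s, ∀ b ∈ l, Q s b) ↔ ∀ b ∈ l, ∃ s, Q s b := by
  refine ⟨fun ⟨s, hs⟩ b hb => ⟨s, hs b hb⟩, fun h => ?_⟩
  have hev : ∀ᶠ s in atTop, ∀ b ∈ {b | b ∈ l}, Q s b :=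
    (eventually_all_finite l.finite_toSet).2 fun b hb =>
      let ⟨s, hs⟩ := h b hb
      (eventually_ge_atTop s).mono fun _ hst => hQ hst b hs
  exact hev.exists

section RecursivelyEnumerable

variable {α β : Type*} [Primcodable α] [Primcodable β]

theorem primrecPred_exists_mem {l : α → List β} {p : α → β → Prop} (hl : Primrec l)
    (hp : PrimrecRel p) : PrimrecPred fun a => ∃ b ∈ l a, p a b :=
  PrimrecRel.exists_mem_list (R := fun b a => p a b)
    (PrimrecRel.comp hp Primrec.snd Primrec.fst) |>.comp hl Primrec.id

theorem primrecPred_forall_mem {l : α → List β} {p : α → β → Prop} (hl : Primrec l)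
    (hp : PrimrecRel p) : PrimrecPred fun a => ∀ b ∈ l a, p a b :=
  PrimrecRel.forall_mem_list (R := fun b a => p a b)
    (PrimrecRel.comp hp Primrec.snd Primrec.fst) |>.comp hl Primrec.id

theorem computablePred_eq {f g : α → β} (hf : Computable f) (hg : Computable g) :
    ComputablePred fun a => f a = g a := by
  classical
  exact (Primrec.eq.decide.to_comp.comp hf hg).computablePred

theorem rePred_comp {p : β → Prop} (hp : REPred p) {f : α → β} (hf : Computable f) :
    REPred fun a => p (f a) :=
  Partrec.comp hp hf

theorem rePred_and {p q : α → Prop} (hp : REPred p) (hq : REPred q) :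
    REPred fun a => p a ∧ q a :=
  (Partrec.bind hp (Partrec.comp hq Computable.fst).to₂).dom_re.of_eq fun a => by
    simp [Part.assert, Part.bind, Part.some]

/-- `Q s` is what a computation that enumerates `p` has found after `s` steps. -/
structure IsStagewise (p : α → Prop) (Q : ℕ → α → Prop) : Prop where
  primrec : PrimrecRel Q
  mono : Monotone Q
  iff : ∀ a, p a ↔ ∃ s, Q s a

theorem exists_isStagewise {p : α → Prop} (hp : REPred p) : ∃ Q, IsStagewise p Q := by
  obtain ⟨c, hc⟩ := Code.exists_code.1 hp
  have dom_iff (a : α) : (c.eval (Encodable.encode a)).Dom ↔ p a := by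
    rw [hc]
    simp [Part.assert, Part.bind, Part.some]
  refine ⟨fun s a => (Code.evaln s c (Encodable.encode a)).isSome = true, ?_, ?_, fun a => ?_⟩
  · exact Primrec.eq.comp (Primrec.option_isSome.comp (Code.primrec_evaln.comp
      ((Primrec.fst.pair (Primrec.const c)).pair (Primrec.encode.comp Primrec.snd))))
      (Primrec.const true)
  · intro s t hst a hs
    obtain ⟨v, hv⟩ := Option.isSome_iff_exists.1 hs
    exact Option.isSome_iff_exists.2 ⟨v, Code.evaln_mono hst hv⟩
  · simp only [← dom_iff, Part.dom_iff_mem, Code.evaln_complete, Option.isSome_iff_exists,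
      Option.mem_def]
    exact exists_comm

theorem exists_partrec_uniformization {p : α → β → Prop}
    (hp : REPred fun q : α × β => p q.1 q.2) :
    ∃ ψ : α →. β, Partrec ψ ∧ (∀ a, ∀ b ∈ ψ a, p a b) ∧ ∀ a, (ψ a).Dom ↔ ∃ b, p a b := by
  classical
  obtain ⟨Q, hQ⟩ := exists_isStagewise hp
  let search (a : α) (n : ℕ) : Option β := (Encodable.decode (α := β) n.unpair.2).bind fun b =>
    if Q n.unpair.1 (a, b) then some b else none
  have hsearch : Primrec₂ search :=
    Primrec.option_bind (Primrec.decode.comp (Primrec.snd.comp (Primrec.unpair.comp Primrec.snd)))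
      (Primrec.ite (hQ.primrec.comp
        (Primrec.fst.comp (Primrec.unpair.comp (Primrec.snd.comp Primrec.fst)))
        ((Primrec.fst.comp Primrec.fst).pair Primrec.snd))
        (Primrec.option_some.comp Primrec.snd) (Primrec.const none))
  have mem_search {a : α} {b : β} {n : ℕ} : b ∈ search a n ↔
      b ∈ Encodable.decode (α := β) n.unpair.2 ∧ Q n.unpair.1 (a, b) := by
    simp [search, Option.bind_eq_some_iff]
  refine ⟨fun a => Nat.rfindOpt (search a), Partrec.rfindOpt hsearch.to_comp, fun a b hb => ?_,
    fun a => Nat.rfindOpt_dom.trans ⟨?_, ?_⟩⟩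
  · obtain ⟨n, hn⟩ := Nat.rfindOpt_spec hb
    exact (hQ.iff (a, b)).2 ⟨_, (mem_search.1 hn).2⟩
  · rintro ⟨n, b, hn⟩
    exact ⟨b, (hQ.iff (a, b)).2 ⟨_, (mem_search.1 hn).2⟩⟩
  · rintro ⟨b, hb⟩
    obtain ⟨s, hs⟩ := (hQ.iff (a, b)).1 hb
    exact ⟨Nat.pair s (Encodable.encode b), b, mem_search.2 (by simpa using hs)⟩

theorem rePred_exists {p : α → β → Prop} (hp : REPred fun q : α × β => p q.1 q.2) :
    REPred fun a => ∃ b, p a b := by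
  obtain ⟨ψ, hψ, -, hdom⟩ := exists_partrec_uniformization hp
  exact hψ.dom_re.of_eq hdom

theorem exists_computable_uniformization {p : α → β → Prop}
    (hp : REPred fun q : α × β => p q.1 q.2) (htotal : ∀ a, ∃ b, p a b) :
    ∃ g : α → β, Computable g ∧ ∀ a, p a (g a) := by
  obtain ⟨ψ, hψ, hψp, hdom⟩ := exists_partrec_uniformization hp
  have hdef (a : α) : (ψ a).Dom := (hdom a).2 (htotal a)
  exact ⟨fun a => (ψ a).get (hdef a), hψ.of_eq_tot fun a => Part.get_mem (hdef a),
    fun a => hψp a _ (Part.get_mem (hdef a))⟩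

theorem rePred_exists_mem_list {l : α → List β} (hl : Computable l) {p : α → β → Prop}
    (hp : REPred fun q : α × β => p q.1 q.2) : REPred fun a => ∃ b ∈ l a, p a b := by
  have hmem : PrimrecPred fun r : List β × β => ∃ b ∈ r.1, b = r.2 :=
    primrecPred_exists_mem (p := fun (r : List β × β) b => b = r.2) Primrec.fst
      (Primrec.eq.comp Primrec.snd (Primrec.snd.comp Primrec.fst))
  have hre : REPred fun q : α × β => q.2 ∈ l q.1 :=
    (rePred_comp hmem.computablePred.to_re
      ((hl.comp Computable.fst).pair Computable.snd)).of_eq fun q => by simp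
  exact rePred_exists (p := fun a b => b ∈ l a ∧ p a b) (rePred_and hre hp)

theorem rePred_forall_mem_list {l : α → List β} (hl : Computable l) {p : α → β → Prop}
    (hp : REPred fun q : α × β => p q.1 q.2) : REPred fun a => ∀ b ∈ l a, p a b := by
  obtain ⟨Q, hQ⟩ := exists_isStagewise hp
  have hprim : PrimrecPred fun r : List β × α × ℕ => ∀ b ∈ r.1, Q r.2.2 (r.2.1, b) :=
    primrecPred_forall_mem Primrec.fst (hQ.primrec.comp
      (Primrec.snd.comp (Primrec.snd.comp Primrec.fst))
      ((Primrec.fst.comp (Primrec.snd.comp Primrec.fst)).pair Primrec.snd))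
  have hre : REPred fun q : α × ℕ => ∀ b ∈ l q.1, Q q.2 (q.1, b) :=
    rePred_comp hprim.computablePred.to_re ((hl.comp Computable.fst).pair Computable.id)
  refine (rePred_exists (p := fun a s => ∀ b ∈ l a, Q s (a, b)) hre).of_eq fun a => ?_
  rw [exists_forall_mem_list_iff (Q := fun s b => Q s (a, b)) fun s t hst b => hQ.mono hst (a, b)]
  exact forall₂_congr fun b _ => (hQ.iff (a, b)).symm

end RecursivelyEnumerable

/-! ### The ascending family -/

/-- `x` is the least element of its `η`-class; `leastRep η` enumerates these numbers. -/
def IsLeader (η : Setoid ℕ) (x : ℕ) : Prop :=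
  ∀ y, η x y → x ≤ y

theorem isLeader_iff_forall_lt {η : Setoid ℕ} {x : ℕ} : IsLeader η x ↔ ∀ z < x, ¬ η x z :=
  forall_congr' fun _ => by rw [← not_lt, imp_not_comm]

theorem IsLeader.eq {η : Setoid ℕ} {x y : ℕ} (hx : IsLeader η x) (hy : IsLeader η y)
    (h : η x y) : x = y :=
  le_antisymm (hx y h) (hy x (η.symm h))

theorem exists_isLeader (η : Setoid ℕ) (x : ℕ) : ∃ y ≤ x, η x y ∧ IsLeader η y := by
  classical
  have hclass : ∃ y, η x y := ⟨x, η.refl x⟩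
  exact ⟨Nat.find hclass, Nat.find_min' hclass (η.refl x), Nat.find_spec hclass,
    fun z hz => Nat.find_min' hclass (η.trans (Nat.find_spec hclass) hz)⟩

theorem infinite_setOf_isLeader (η : Setoid ℕ) [Infinite (Quotient η)] :
    {x | IsLeader η x}.Infinite := by
  refine Set.infinite_coe_iff.1 (Infinite.of_surjective
    (fun y : {x | IsLeader η x} => Quotient.mk η y.1) fun q => ?_)
  induction q using Quotient.inductionOn with
  | h x =>
    obtain ⟨y, -, hxy, hy⟩ := exists_isLeader η x
    exact ⟨⟨y, hy⟩, Quotient.sound (η.symm hxy)⟩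

theorem ascendingSet_mono (η : Setoid ℕ) : Monotone (ascendingSet η) :=
  fun _ _ hkl _ ⟨m, hm, hx⟩ => ⟨m, hm.trans_le hkl, hx⟩

theorem isEtaClosed_ascendingSet (η : Setoid ℕ) (n : ℕ) : IsEtaClosed η (ascendingSet η n) :=
  fun _ ⟨m, hm, hx⟩ _ hxy => ⟨m, hm, η.trans (η.symm hxy) hx⟩

section AscendingSet

variable {η : Setoid ℕ} [Infinite (Quotient η)]

theorem leastRep_strictMono : StrictMono (leastRep η) :=
  Nat.nth_strictMono (infinite_setOf_isLeader η)

theorem isLeader_leastRep (n : ℕ) : IsLeader η (leastRep η n) :=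
  Nat.nth_mem_of_infinite (infinite_setOf_isLeader η) n

theorem leastRep_equiv_iff {m n : ℕ} : η (leastRep η m) (leastRep η n) ↔ m = n :=
  ⟨fun h => leastRep_strictMono.injective ((isLeader_leastRep m).eq (isLeader_leastRep n) h),
    fun h => h ▸ η.refl _⟩

theorem exists_equiv_leastRep (x : ℕ) : ∃ n, leastRep η n ≤ x ∧ η x (leastRep η n) := by
  obtain ⟨y, hyx, hxy, hy⟩ := exists_isLeader η x
  obtain ⟨n, rfl⟩ : y ∈ Set.range (leastRep η) :=
    (Nat.range_nth_of_infinite (infinite_setOf_isLeader η)).symm ▸ hy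
  exact ⟨n, hyx, hxy⟩

theorem leastRep_mem_ascendingSet_iff {m n : ℕ} : leastRep η m ∈ ascendingSet η n ↔ m < n := by
  simp [ascendingSet, leastRep_equiv_iff]

theorem ascendingSet_strictMono : StrictMono (ascendingSet η) := fun m _ hmn =>
  (ascendingSet_mono η hmn.le).ssubset_of_not_subset fun h =>
    lt_irrefl m (leastRep_mem_ascendingSet_iff.1 (h (leastRep_mem_ascendingSet_iff.2 hmn)))

theorem mem_ascendingSet_iff_exists_lt_leastRep {n x : ℕ} :
    x ∈ ascendingSet η n ↔ ∃ y < leastRep η n, η x y := by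
  constructor
  · rintro ⟨m, hm, hx⟩
    exact ⟨_, leastRep_strictMono hm, hx⟩
  · rintro ⟨y, hy, hxy⟩
    obtain ⟨m, hmy, hym⟩ := exists_equiv_leastRep (η := η) y
    exact ⟨m, leastRep_strictMono.lt_iff_lt.1 (hmy.trans_lt hy), η.trans hxy hym⟩

theorem Iic_subset_ascendingSet_succ (n : ℕ) : Set.Iic n ⊆ ascendingSet η (n + 1) := fun x hx =>
  mem_ascendingSet_iff_exists_lt_leastRep.2
    ⟨x, (Nat.lt_succ_of_le hx).trans_le (leastRep_strictMono.le_apply), η.refl x⟩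

/-- Unlike the definition, this does not mention minimality in a class, which is only co-r.e. -/
theorem mem_ascendingSet_iff_exists_cover {n x : ℕ} : x ∈ ascendingSet η n ↔
    ∃ c : List ℕ × ℕ, c.1.length ≤ n ∧ η x c.2 ∧ ∀ z ∈ List.range (c.2 + 1), ∃ w ∈ c.1, η z w := by
  constructor
  · rintro ⟨m, hm, hx⟩
    refine ⟨((List.range (m + 1)).map (leastRep η), leastRep η m), by simpa using hm, hx,
      fun z hz => ?_⟩
    obtain ⟨k, hkz, hzk⟩ := exists_equiv_leastRep (η := η) z
    have hkm : k ≤ m :=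
      leastRep_strictMono.le_iff_le.1 (hkz.trans (Nat.lt_succ_iff.1 (List.mem_range.1 hz)))
    exact ⟨_, List.mem_map_of_mem (List.mem_range.2 (Nat.lt_succ_of_le hkm)), hzk⟩
  · rintro ⟨⟨l, y⟩, hl, hxy, hcover⟩
    obtain ⟨m, hmy, hym⟩ := exists_equiv_leastRep (η := η) y
    refine ⟨m, ?_, η.trans hxy hym⟩
    have hcard : (Finset.range (m + 1)).card ≤ l.toFinset.card := by
      refine Finset.card_le_card_of_forall_subsingleton (fun k w => η (leastRep η k) w)
        (fun k hk => ?_) fun w _ j hj k hk => leastRep_equiv_iff.1 (η.trans hj.2 (η.symm hk.2))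
      have hky : leastRep η k ≤ y :=
        (leastRep_strictMono.monotone (Finset.mem_range_succ_iff.1 hk)).trans hmy
      obtain ⟨w, hw, hkw⟩ := hcover _ (List.mem_range.2 (Nat.lt_succ_of_le hky))
      exact ⟨w, List.mem_toFinset.2 hw, hkw⟩
    rw [Finset.card_range] at hcard
    exact hcard.trans ((List.toFinset_card_le l).trans hl)

theorem uniformlyRE_ascendingSet (hη : REPred fun p : ℕ × ℕ => η p.1 p.2) :
    UniformlyRE (ascendingSet η) := by
  let IsCover (c : List ℕ × ℕ) : Prop := ∀ z ∈ List.range (c.2 + 1), ∃ w ∈ c.1, η z w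
  have hequiv {α : Type} [Primcodable α] {f g : α → ℕ} (hf : Computable f) (hg : Computable g) :
      REPred fun a => η (f a) (g a) :=
    rePred_comp (p := fun p : ℕ × ℕ => η p.1 p.2) hη (hf.pair hg)
  have hcover : REPred IsCover :=
    rePred_forall_mem_list (p := fun (c : List ℕ × ℕ) z => ∃ w ∈ c.1, η z w)
      (Primrec.list_range.comp (Primrec.succ.comp Primrec.snd)).to_comp
      (rePred_exists_mem_list (p := fun (r : (List ℕ × ℕ) × ℕ) w => η r.2 w)
        (Computable.fst.comp Computable.fst)
        (hequiv (Computable.snd.comp Computable.fst) Computable.snd))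
  have hlength : REPred fun q : (ℕ × ℕ) × List ℕ × ℕ => q.2.1.length ≤ q.1.1 :=
    (Primrec.nat_le.comp (Primrec.list_length.comp (Primrec.fst.comp Primrec.snd))
      (Primrec.fst.comp Primrec.fst)).computablePred.to_re
  have hbody := rePred_and hlength (rePred_and
    (hequiv (Computable.snd.comp Computable.fst) (Computable.snd.comp Computable.snd))
    (rePred_comp hcover Computable.snd))
  exact (rePred_exists (p := fun (q : ℕ × ℕ) (c : List ℕ × ℕ) =>
    c.1.length ≤ q.1 ∧ η q.2 c.2 ∧ IsCover c) hbody).of_eq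
    fun _ => mem_ascendingSet_iff_exists_cover.symm

end AscendingSet

theorem LimitFromBelow.le_iff_exists {f : ℕ → ℕ} (hf : LimitFromBelow f) :
    ∃ F : ℕ → ℕ → ℕ, Computable₂ F ∧ ∀ n m, m ≤ f n ↔ ∃ s, m ≤ F n s := by
  obtain ⟨F, hF, hmono, hlim⟩ := hf
  refine ⟨F, hF, fun n m => ?_⟩
  obtain ⟨s₀, hs₀⟩ := hlim n
  refine ⟨fun hm => ⟨s₀, (hs₀ s₀ le_rfl).symm ▸ hm⟩, fun ⟨s, hs⟩ => ?_⟩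
  calc m ≤ F n s := hs
    _ ≤ F n (max s s₀) := hmono n (le_max_left s s₀)
    _ = f n := hs₀ _ (le_max_right s s₀)

theorem LimitFromBelow.rePred_le {f : ℕ → ℕ} (hf : LimitFromBelow f) :
    REPred fun q : ℕ × ℕ => q.2 ≤ f q.1 := by
  obtain ⟨F, hF, hle⟩ := hf.le_iff_exists
  have hre : REPred fun q : (ℕ × ℕ) × ℕ => q.1.2 ≤ F q.1.1 q.2 :=
    rePred_comp (p := fun r : ℕ × ℕ => r.1 ≤ r.2) Primrec.nat_le.computablePred.to_re
      ((Computable.snd.comp Computable.fst).pair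
        (hF.comp (Computable.fst.comp Computable.fst) Computable.snd))
  exact (rePred_exists (p := fun (q : ℕ × ℕ) s => q.2 ≤ F q.1 s) hre).of_eq
    fun q => (hle q.1 q.2).symm

theorem UniformlyRE.comp_limitFromBelow {H : ℕ → Set ℕ} (hH : UniformlyRE H) (hmono : Monotone H)
    {f : ℕ → ℕ} (hf : LimitFromBelow f) : UniformlyRE fun n => H (f n) := by
  have hre : REPred fun q : (ℕ × ℕ) × ℕ => q.2 ≤ f q.1.1 ∧ q.1.2 ∈ H q.2 :=
    rePred_and
      (rePred_comp hf.rePred_le ((Computable.fst.comp Computable.fst).pair Computable.snd))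
      (rePred_comp hH (Computable.snd.pair (Computable.snd.comp Computable.fst)))
  exact (rePred_exists (p := fun (q : ℕ × ℕ) m => m ≤ f q.1 ∧ q.2 ∈ H m) hre).of_eq fun q =>
    ⟨fun ⟨_, hm, hx⟩ => hmono hm hx, fun hx => ⟨_, le_rfl, hx⟩⟩

theorem uniformlyRE_ascendingSet_succ_comp {η : Setoid ℕ} [Infinite (Quotient η)]
    (hη : REPred fun p : ℕ × ℕ => η p.1 p.2) {f : ℕ → ℕ} (hf : LimitFromBelow f) :
    UniformlyRE fun n => ascendingSet η (f n + 1) := by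
  have hsucc : UniformlyRE fun m => ascendingSet η (m + 1) :=
    rePred_comp (p := fun p : ℕ × ℕ => p.2 ∈ ascendingSet η p.1) (uniformlyRE_ascendingSet hη)
      ((Computable.succ.comp Computable.fst).pair Computable.snd)
  exact hsucc.comp_limitFromBelow (fun _ _ h => ascendingSet_mono η (Nat.succ_le_succ h)) hf

/-! ### A dominating function that is a limit from below -/

theorem computable_sum_range {α : Type*} [Primcodable α] {k : α → ℕ} {g : α → ℕ → ℕ}
    (hk : Computable k) (hg : Computable₂ g) :
    Computable fun a => ∑ i ∈ Finset.range (k a), g a i := by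
  have hstep : Computable₂ fun (a : α) (q : ℕ × ℕ) => q.2 + g a q.1 :=
    Primrec.nat_add.to_comp.comp (Computable.snd.comp Computable.snd)
      (hg.comp Computable.fst (Computable.fst.comp Computable.snd))
  refine (Computable.nat_rec hk (Computable.const 0) hstep).of_eq fun a => ?_
  induction k a with
  | zero => rfl
  | succ n ih => rw [Finset.sum_range_succ, ← ih]

/-- The value at `y` of the `e`-th program, where `p` codes `(e, y)`, or `0` if it diverges. -/
noncomputable def programValue (p : ℕ) : ℕ :=
  open Classical in ((Denumerable.ofNat Code p.unpair.1).eval p.unpair.2).getOrElse 0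

theorem limitFromBelow_programValue : LimitFromBelow programValue := by
  have hbounded : Computable₂ fun p s : ℕ =>
      (Code.evaln s (Denumerable.ofNat Code p.unpair.1) p.unpair.2).getD 0 :=
    (Primrec.option_getD.comp (Code.primrec_evaln.comp
      ((Primrec.snd.pair ((Primrec.ofNat Code).comp
        (Primrec.fst.comp (Primrec.unpair.comp Primrec.fst)))).pair
        (Primrec.snd.comp (Primrec.unpair.comp Primrec.fst)))) (Primrec.const 0)).to_comp
  refine ⟨_, hbounded, fun p s t hst => ?_, fun p => ?_⟩
  · rcases hs : Code.evaln s (Denumerable.ofNat Code p.unpair.1) p.unpair.2 with _ | v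
    · simp [hs]
    · simp [hs, Option.mem_def.1 (Code.evaln_mono hst hs)]
  · classical
    rw [programValue]
    by_cases hdom : ((Denumerable.ofNat Code p.unpair.1).eval p.unpair.2).Dom
    · obtain ⟨s₀, hs₀⟩ := Code.evaln_complete.1 (Part.get_mem hdom)
      refine ⟨s₀, fun s hs => ?_⟩
      rw [Option.mem_def.1 (Code.evaln_mono hs hs₀), Option.getD_some, Part.getOrElse_of_dom _ hdom]
    · refine ⟨0, fun s _ => ?_⟩
      rw [Part.getOrElse_of_not_dom _ hdom, Option.eq_none_iff_forall_not_mem.2 fun v hv =>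
        hdom (Part.dom_iff_mem.2 ⟨v, Code.evaln_sound hv⟩), Option.getD_none]

theorem exists_programValue_eq {g : ℕ → ℕ} (hg : Computable g) :
    ∃ e, ∀ n, programValue (Nat.pair e n) = g n := by
  obtain ⟨c, hc⟩ := Code.exists_code.1 (Partrec.nat_iff.1 hg.partrec)
  refine ⟨Encodable.encode c, fun n => ?_⟩
  classical
  have hdom : (c.eval n).Dom := by rw [hc]; trivial
  rw [programValue, Nat.unpair_pair, Denumerable.ofNat_encode, Part.getOrElse_of_dom _ hdom]
  exact Part.get_eq_of_mem (by rw [hc]; exact Part.mem_some _) hdom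

/-- A strictly increasing function that is at least `v (Nat.pair e n)` at `n` for every `e ≤ n`. -/
def majorant (v : ℕ → ℕ) (n : ℕ) : ℕ :=
  n + ∑ p ∈ Finset.range ((n + 1) ^ 2), v p

theorem majorant_strictMono (v : ℕ → ℕ) : StrictMono (majorant v) := fun _ _ hmn =>
  Nat.add_lt_add_of_lt_of_le hmn (Finset.sum_le_sum_of_subset (Finset.range_subset_range.2
    (Nat.pow_le_pow_left (Nat.succ_le_succ hmn.le) 2)))

theorem le_majorant (v : ℕ → ℕ) {e n : ℕ} (hen : e ≤ n) : v (Nat.pair e n) ≤ majorant v n := by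
  have hlt : Nat.pair e n < (n + 1) ^ 2 := by
    simpa only [max_eq_right hen] using Nat.pair_lt_max_add_one_sq e n
  exact (Finset.single_le_sum (fun _ _ => Nat.zero_le _) (Finset.mem_range.2 hlt)).trans
    (Nat.le_add_left _ _)

theorem limitFromBelow_majorant {v : ℕ → ℕ} (hv : LimitFromBelow v) :
    LimitFromBelow (majorant v) := by
  obtain ⟨V, hV, hmono, hlim⟩ := hv
  refine ⟨fun n s => majorant (V · s) n, ?_, fun n s t hst => ?_, fun n => ?_⟩
  · exact Primrec.nat_add.to_comp.comp Computable.fst (computable_sum_range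
      ((Primrec.nat_mul.comp (Primrec.succ.comp Primrec.fst) (Primrec.succ.comp
        Primrec.fst)).to_comp.of_eq fun q => (sq (q.1 + 1)).symm)
      (hV.comp Computable.snd (Computable.snd.comp Computable.fst)))
  · exact Nat.add_le_add_left (Finset.sum_le_sum fun p _ => hmono p hst) n
  · have hev : ∀ᶠ s in atTop, ∀ p ∈ Finset.range ((n + 1) ^ 2), V p s = v p :=
      (eventually_all_finset _).2 fun p _ => eventually_atTop.2 (hlim p)
    exact eventually_atTop.1 (hev.mono fun s hs => congrArg (n + ·) (Finset.sum_congr rfl hs))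

theorem dominatesRecursive_majorant_programValue : DominatesRecursive (majorant programValue) := by
  intro g hg
  obtain ⟨e, he⟩ := exists_programValue_eq hg
  exact ⟨e, fun n hn => he n ▸ le_majorant programValue hn⟩

/-! ### Finite sequences and texts -/

theorem content_append (σ τ : List (Option ℕ)) : content (σ ++ τ) = content σ ∪ content τ := by
  ext x
  exact List.mem_append

theorem mem_reduceOption_iff_mem_content {σ : List (Option ℕ)} {x : ℕ} :
    x ∈ σ.reduceOption ↔ x ∈ content σ :=
  List.reduceOption_mem_iff

theorem content_subset_Iic_encode (σ : List (Option ℕ)) :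
    content σ ⊆ Set.Iic (Encodable.encode σ) := by
  intro x hx
  induction σ with
  | nil => exact absurd hx List.not_mem_nil
  | cons o σ ih =>
    rw [Set.mem_Iic, Encodable.encode_list_cons]
    rcases List.mem_cons.1 hx with rfl | hx
    · exact ((Nat.le_succ x).trans (Nat.left_le_pair _ _)).trans (Nat.le_succ _)
    · exact ((ih hx).trans (Nat.right_le_pair _ _)).trans (Nat.le_succ _)

theorem length_initSeg (T : ℕ → Option ℕ) (n : ℕ) : (initSeg T n).length = n := by
  simp [initSeg]

theorem initSeg_add (T : ℕ → Option ℕ) (n k : ℕ) :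
    initSeg T (n + k) = initSeg T n ++ initSeg (fun i => T (n + i)) k := by
  simp [initSeg, List.range_add, Function.comp_def]

theorem content_initSeg_mono (T : ℕ → Option ℕ) : Monotone fun n => content (initSeg T n) := by
  intro m n hmn
  obtain ⟨k, rfl⟩ := Nat.exists_eq_add_of_le hmn
  simp only [initSeg_add, content_append]
  exact Set.subset_union_left

theorem mem_content_initSeg {T : ℕ → Option ℕ} {n x : ℕ} :
    x ∈ content (initSeg T n) ↔ ∃ i < n, T i = some x := by
  simp [content, initSeg]

theorem IsText.content_initSeg_subset {T : ℕ → Option ℕ} {L : Set ℕ} (hT : IsText T L) (n : ℕ) :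
    content (initSeg T n) ⊆ L := fun _ hx =>
  let ⟨i, _, hi⟩ := mem_content_initSeg.1 hx
  hT ▸ ⟨i, hi⟩

theorem IsText.exists_mem_content {T : ℕ → Option ℕ} {L : Set ℕ} (hT : IsText T L) {x : ℕ}
    (hx : x ∈ L) : ∃ n, x ∈ content (initSeg T n) := by
  rw [← hT] at hx
  obtain ⟨i, hi⟩ := hx
  exact ⟨i + 1, mem_content_initSeg.2 ⟨i, i.lt_succ_self, hi⟩⟩

theorem exists_isText (L : Set ℕ) : ∃ T, IsText T L := by
  classical
  refine ⟨fun i => if i ∈ L then some i else none, ?_⟩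
  ext x
  simp [Option.ite_none_right_eq_some]

theorem exists_isText_initSeg_eq_take {σ : List (Option ℕ)} {L : Set ℕ} (hσ : content σ ⊆ L) :
    ∃ T, IsText T L ∧ ∀ n ≤ σ.length, initSeg T n = σ.take n := by
  obtain ⟨T, hT⟩ := exists_isText L
  refine ⟨fun i => if h : i < σ.length then σ[i] else T (i - σ.length), ?_, fun n hn => ?_⟩
  · ext x
    constructor
    · rintro ⟨i, hi⟩
      dsimp only at hi
      split_ifs at hi with h
      · exact hσ (hi ▸ List.getElem_mem h : some x ∈ σ)
      · exact hT ▸ ⟨_, hi⟩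
    · intro hx
      rw [← hT] at hx
      obtain ⟨i, hi⟩ := hx
      exact ⟨σ.length + i, by simpa using hi⟩
  · refine List.ext_getElem (by simp [length_initSeg, hn]) fun i hi _ => ?_
    rw [length_initSeg] at hi
    simp [initSeg, hi.trans_le hn]

/-! ### No class-preserving conservative learner -/

/-- On a sequence between `σ` and its extension `τ` the learner conjectures a set that contains
the data seen so far, and on `τ` it has given up this conjecture. The data are checked because
that makes the relation r.e. while `H_e` is only r.e. -/
def IsMindChange (H : ℕ → Set ℕ) (M : Learner) (σ τ : List (Option ℕ)) : Prop :=
  ∃ u v e, τ = σ ++ u ++ v ∧ M (σ ++ u) = some e ∧ M τ ≠ some e ∧ content (σ ++ u) ⊆ H e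

theorem rePred_content_subset {α : Type*} [Primcodable α] {H : ℕ → Set ℕ} (hH : UniformlyRE H)
    {σ : α → List (Option ℕ)} (hσ : Computable σ) {e : α → ℕ} (he : Computable e) :
    REPred fun a => content (σ a) ⊆ H (e a) := by
  have hreduce : Computable fun a => (σ a).reduceOption :=
    (Primrec.listFilterMap Primrec.id Primrec.snd.to₂).to_comp.comp hσ
  have hmem : REPred fun q : α × ℕ => q.2 ∈ H (e q.1) :=
    rePred_comp (p := fun p : ℕ × ℕ => p.2 ∈ H p.1) hH
      ((he.comp Computable.fst).pair Computable.snd)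
  exact (rePred_forall_mem_list (p := fun a x => x ∈ H (e a)) hreduce hmem).of_eq fun a =>
    forall_congr' fun x => by rw [mem_reduceOption_iff_mem_content]

theorem rePred_isMindChange {H : ℕ → Set ℕ} (hH : UniformlyRE H) {M : Learner}
    (hM : Computable M) :
    REPred fun q : List (Option ℕ) × List (Option ℕ) => IsMindChange H M q.1 q.2 := by
  let ι := (List (Option ℕ) × List (Option ℕ)) × List (Option ℕ) × List (Option ℕ) × ℕ
  have hτ : Computable fun q : ι => q.1.2 := Computable.snd.comp Computable.fst
  have hσu : Computable fun q : ι => q.1.1 ++ q.2.1 :=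
    Computable.list_append.comp (Computable.fst.comp Computable.fst)
      (Computable.fst.comp Computable.snd)
  have hv : Computable fun q : ι => q.2.2.1 :=
    Computable.fst.comp (Computable.snd.comp Computable.snd)
  have he : Computable fun q : ι => q.2.2.2 :=
    Computable.snd.comp (Computable.snd.comp Computable.snd)
  have hbody : REPred fun q : ι => q.1.2 = q.1.1 ++ q.2.1 ++ q.2.2.1 ∧
      M (q.1.1 ++ q.2.1) = some q.2.2.2 ∧ M q.1.2 ≠ some q.2.2.2 ∧
        content (q.1.1 ++ q.2.1) ⊆ H q.2.2.2 :=
    rePred_and (computablePred_eq hτ (Computable.list_append.comp hσu hv)).to_re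
      (rePred_and (computablePred_eq (hM.comp hσu) (Computable.option_some.comp he)).to_re
        (rePred_and (computablePred_eq (hM.comp hτ) (Computable.option_some.comp he)).not.to_re
          (rePred_content_subset hH hσu he)))
  refine (rePred_exists (p := fun (p : List (Option ℕ) × List (Option ℕ))
    (r : List (Option ℕ) × List (Option ℕ) × ℕ) => p.2 = p.1 ++ r.1 ++ r.2.1 ∧
      M (p.1 ++ r.1) = some r.2.2 ∧ M p.2 ≠ some r.2.2 ∧ content (p.1 ++ r.1) ⊆ H r.2.2)
    hbody).of_eq fun _ => ?_
  simp only [IsMindChange, Prod.exists]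

theorem ExLearns.exists_extension {H : ℕ → Set ℕ} {M : Learner} {C : Set (Set ℕ)}
    (hM : ExLearns H M C) {L : Set ℕ} (hL : L ∈ C) {σ : List (Option ℕ)} (hσ : content σ ⊆ L) :
    ∃ u e, M (σ ++ u) = some e ∧ H e = L ∧ content (σ ++ u) ⊆ L := by
  obtain ⟨T, hT, hTσ⟩ := exists_isText_initSeg_eq_take hσ
  obtain ⟨n, e, he, hHe, hconv⟩ := hM L hL T hT
  obtain ⟨u, hu⟩ : ∃ u, initSeg T (σ.length + n) = σ ++ u :=
    ⟨_, by rw [initSeg_add, hTσ _ le_rfl, List.take_length]⟩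
  exact ⟨u, e, hu ▸ (hconv _ (Nat.le_add_left _ _)).trans he, hHe,
    hu ▸ hT.content_initSeg_subset _⟩

theorem ExLearns.exists_isMindChange {H : ℕ → Set ℕ} {M : Learner} {C : Set (Set ℕ)}
    (hM : ExLearns H M C) {L L' : Set ℕ} (hL : L ∈ C) (hL' : L' ∈ C) (hLL' : L ⊂ L')
    {σ : List (Option ℕ)} (hσ : content σ ⊆ L) : ∃ τ, IsMindChange H M σ τ := by
  obtain ⟨u, e, he, hHe, hu⟩ := hM.exists_extension hL hσ
  obtain ⟨v, e', he', hHe', -⟩ := hM.exists_extension hL' (hu.trans hLL'.subset)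
  refine ⟨σ ++ u ++ v, u, v, e, rfl, he, fun h => hLL'.ne ?_, hHe ▸ hu⟩
  rw [← hHe, ← hHe', Option.some.inj (h.symm.trans he')]

theorem IsConservative.not_content_subset {H : ℕ → Set ℕ} {M : Learner} {C : Set (Set ℕ)}
    (hM : IsConservative H M C) {L : Set ℕ} (hL : L ∈ C) {σ v : List (Option ℕ)} {e : ℕ}
    (hsub : content (σ ++ v) ⊆ L) (he : M σ = some e) (hne : M (σ ++ v) ≠ some e) :
    ¬ content (σ ++ v) ⊆ H e := by
  obtain ⟨T, hT, htake⟩ := exists_isText_initSeg_eq_take hsub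
  have hσ : initSeg T σ.length = σ := by
    rw [htake _ (by simp), List.take_left]
  have hσv : initSeg T (σ.length + v.length) = σ ++ v := by
    rw [← List.length_append, htake _ le_rfl, List.take_length]
  have hv : v ≠ [] := fun h => hne (by rw [h, List.append_nil, he])
  have hchange := hM L hL T hT σ.length v.length e (List.length_pos_iff.2 hv)
  rw [hσ, hσv, he] at hchange
  exact hchange rfl hne.symm

/-- The conjecture that is given up is some `B_k` containing the data of `σ`, so `i ≤ k`, and by
conservativity `B_k` does not contain the data of `τ`. -/
theorem IsConservative.not_content_subset_of_isMindChange {H B : ℕ → Set ℕ} {M : Learner}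
    (hM : IsConservative H M (Set.range B)) (hB : Monotone B) (hH : Set.range H ⊆ Set.range B)
    {σ τ : List (Option ℕ)} (hστ : IsMindChange H M σ τ) {i m : ℕ} (hτ : content τ ⊆ B m)
    (hσ : ∀ j < i, ¬ content σ ⊆ B j) : ¬ content τ ⊆ B i := by
  obtain ⟨u, v, e, rfl, he, hne, hu⟩ := hστ
  obtain ⟨k, hk⟩ := hH ⟨e, rfl⟩
  have hik : i ≤ k := not_lt.1 fun hki => hσ k hki
    ((Set.subset_union_left.trans (content_append σ u).ge).trans (hk ▸ hu))
  exact fun hi => hM.not_content_subset ⟨m, rfl⟩ hτ he hne (hk ▸ hi.trans (hB hik))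

theorem computable_iterate {α : Type*} [Primcodable α] {g : α → α} (hg : Computable g) (a : α) :
    Computable fun n => g^[n] a :=
  (Computable.nat_rec Computable.id (Computable.const a)
    (hg.comp (Computable.snd.comp Computable.snd)).to₂).of_eq fun n => by
      induction n with
      | zero => rfl
      | succ n ih => rw [Function.iterate_succ_apply', ← ih]; rfl

theorem DominatesRecursive.exists_content_subset {B : ℕ → Set ℕ} {f : ℕ → ℕ}
    (hf : DominatesRecursive f) (hfB : ∀ n, Set.Iic (f n) ⊆ B n) (σ : List (Option ℕ)) :
    ∃ n, content σ ⊆ B n := by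
  obtain ⟨n₀, hn₀⟩ := hf _ (Computable.const (Encodable.encode σ))
  exact ⟨n₀, (content_subset_Iic_encode σ).trans
    ((Set.Iic_subset_Iic.2 (hn₀ n₀ le_rfl)).trans (hfB n₀))⟩

theorem not_classPreservingConsExLearnable_range {B : ℕ → Set ℕ} {f : ℕ → ℕ} (hB : StrictMono B)
    (hf : DominatesRecursive f) (hfB : ∀ n, Set.Iic (f n) ⊆ B n) :
    ¬ ClassPreservingConsExLearnable (Set.range B) := by
  rintro ⟨H, hH, hHB, M, hM, hex, hcons⟩
  have hchange (σ : List (Option ℕ)) : ∃ τ, IsMindChange H M σ τ :=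
    let ⟨n, hn⟩ := hf.exists_content_subset hfB σ
    hex.exists_isMindChange ⟨n, rfl⟩ ⟨n + 1, rfl⟩ (hB n.lt_succ_self) hn
  obtain ⟨g, hg, hgM⟩ := exists_computable_uniformization (rePred_isMindChange hH hM) hchange
  have hescape (n : ℕ) : ∀ j < n, ¬ content (g^[n] []) ⊆ B j := by
    induction n with
    | zero => exact fun j hj => absurd hj j.not_lt_zero
    | succ n ih =>
      intro j hj
      rw [Function.iterate_succ_apply']
      obtain ⟨m, hm⟩ := hf.exists_content_subset hfB (g (g^[n] []))
      exact fun hsub => hcons.not_content_subset_of_isMindChange hB.monotone hHB.subset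
        (hgM _) hm ih (hsub.trans (hB.monotone (Nat.lt_succ_iff.1 hj)))
  obtain ⟨n₀, hn₀⟩ := hf (fun n => Encodable.encode (g^[n + 1] []))
    (Computable.encode.comp ((computable_iterate hg []).comp Computable.succ))
  exact hescape (n₀ + 1) n₀ n₀.lt_succ_self ((content_subset_Iic_encode _).trans
    ((Set.Iic_subset_Iic.2 (hn₀ n₀ le_rfl)).trans (hfB n₀)))

/-! ### Conservative learning by enumeration -/

/-- `R σ b` is a decidable sufficient reason for the data `σ` not to be contained in `H b`; it
persists when more data arrive, and on texts for members of `C` it is found eventually. -/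
structure IsRefutation (H : ℕ → Set ℕ) (C : Set (Set ℕ)) (R : List (Option ℕ) → ℕ → Prop) :
    Prop where
  computable : ComputablePred fun q : List (Option ℕ) × ℕ => R q.1 q.2
  sound : ∀ {σ b}, R σ b → ¬ content σ ⊆ H b
  append : ∀ {σ b}, R σ b → ∀ τ, R (σ ++ τ) b
  complete : ∀ {L T b}, L ∈ C → IsText T L → ¬ L ⊆ H b → ∃ n, R (initSeg T n) b

section Enumeration

variable {H : ℕ → Set ℕ} {C : Set (Set ℕ)} {R : List (Option ℕ) → ℕ → Prop}

theorem IsRefutation.mono (hR : IsRefutation H C R) (T : ℕ → Option ℕ) {m n b : ℕ} (hmn : m ≤ n)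
    (h : R (initSeg T m) b) : R (initSeg T n) b := by
  obtain ⟨k, rfl⟩ := Nat.exists_eq_add_of_le hmn
  exact initSeg_add T m k ▸ hR.append h _

theorem exists_not_refuted_or_length_le (R : List (Option ℕ) → ℕ → Prop) (σ : List (Option ℕ)) :
    ∃ b, ¬ R σ b ∨ σ.length ≤ b :=
  ⟨σ.length, Or.inr le_rfl⟩

open Classical in
/-- The least `b` that `R` does not refute, searched for only up to the length of the data. -/
noncomputable def leastUnrefuted (R : List (Option ℕ) → ℕ → Prop) (σ : List (Option ℕ)) : ℕ :=
  Nat.find (exists_not_refuted_or_length_le R σ)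

theorem computable_leastUnrefuted
    (hR : ComputablePred fun q : List (Option ℕ) × ℕ => R q.1 q.2) :
    Computable (leastUnrefuted R) := by
  classical
  have hbound : Primrec fun q : List (Option ℕ) × ℕ => decide (q.1.length ≤ q.2) :=
    Primrec.nat_le.decide.comp (Primrec.list_length.comp Primrec.fst) Primrec.snd
  have hcomp : ComputablePred fun q : List (Option ℕ) × ℕ => ¬ R q.1 q.2 ∨ q.1.length ≤ q.2 :=
    computablePred_iff_computable_decide.2 <|
      (Primrec.or.to_comp.comp hR.not.decide hbound.to_comp).of_eq fun q => by
        rw [Bool.decide_or]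
  exact Computable.find hcomp (exists_not_refuted_or_length_le R)

theorem not_refuted_leastUnrefuted (σ : List (Option ℕ)) :
    ¬ R σ (leastUnrefuted R σ) ∨ σ.length ≤ leastUnrefuted R σ := by
  classical
  exact Nat.find_spec (exists_not_refuted_or_length_le R σ)

theorem refuted_of_lt_leastUnrefuted {σ : List (Option ℕ)} {b : ℕ} (hb : b < leastUnrefuted R σ) :
    R σ b := by
  classical
  exact not_not.1 fun h => Nat.find_min (exists_not_refuted_or_length_le R σ) hb (Or.inl h)

theorem leastUnrefuted_le {σ : List (Option ℕ)} {b : ℕ} (hb : ¬ R σ b) :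
    leastUnrefuted R σ ≤ b :=
  not_lt.1 fun h => hb (refuted_of_lt_leastUnrefuted h)

theorem leastUnrefuted_le_length (σ : List (Option ℕ)) : leastUnrefuted R σ ≤ σ.length := by
  classical
  exact Nat.find_min' (exists_not_refuted_or_length_le R σ) (Or.inr le_rfl)

theorem IsRefutation.monotone_leastUnrefuted (hR : IsRefutation H C R) (T : ℕ → Option ℕ) :
    Monotone fun n => leastUnrefuted R (initSeg T n) := by
  intro m n hmn
  by_contra! hlt
  rcases not_refuted_leastUnrefuted (R := R) (initSeg T n) with h | h
  · exact h (hR.mono T hmn (refuted_of_lt_leastUnrefuted hlt))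
  · have hm := leastUnrefuted_le_length (R := R) (initSeg T m)
    rw [length_initSeg] at h hm
    exact lt_irrefl n (h.trans_lt (hlt.trans_le (hm.trans hmn)))

theorem IsRefutation.eventually_leastUnrefuted_eq (hR : IsRefutation H C R) {L : Set ℕ}
    {T : ℕ → Option ℕ} (hL : L ∈ C) (hT : IsText T L) {a : ℕ} (ha : H a = L)
    (hmin : ∀ b < a, ¬ L ⊆ H b) : ∀ᶠ n in atTop, leastUnrefuted R (initSeg T n) = a := by
  have hrefuted : ∀ᶠ n in atTop, ∀ b ∈ Set.Iio a, R (initSeg T n) b :=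
    (eventually_all_finite (Set.finite_Iio a)).2 fun b hb =>
      let ⟨m, hm⟩ := hR.complete hL hT (hmin b hb)
      (eventually_ge_atTop m).mono fun _ hmn => hR.mono T hmn hm
  filter_upwards [hrefuted, eventually_ge_atTop a] with n hn han
  have hna : ¬ R (initSeg T n) a := fun h => hR.sound h (ha ▸ hT.content_initSeg_subset n)
  refine (leastUnrefuted_le hna).antisymm (not_lt.1 fun hlt => ?_)
  rcases not_refuted_leastUnrefuted (R := R) (initSeg T n) with h | h
  · exact h (hn _ hlt)
  · rw [length_initSeg] at h
    exact (h.trans_lt hlt).not_ge han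

theorem IsRefutation.consExLearnableWrt (hR : IsRefutation H C R)
    (hC : ∀ L ∈ C, ∃ a, H a = L ∧ ∀ b < a, H b ⊆ L) : ConsExLearnableWrt H C := by
  classical
  refine ⟨fun σ => some (leastUnrefuted R σ),
    Computable.option_some.comp (computable_leastUnrefuted hR.computable),
    fun L hL T hT => ?_, fun L _ T _ n k e _ he hne hsub => ?_⟩
  · obtain ⟨a, ha, hsub⟩ := hC L hL
    have hex : ∃ b, L ⊆ H b := ⟨a, ha.ge⟩
    have hfind : H (Nat.find hex) = L := by
      rcases (Nat.find_min' hex ha.ge).lt_or_eq with hlt | heq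
      · exact (hsub _ hlt).antisymm (Nat.find_spec hex)
      · rw [heq, ha]
    obtain ⟨n, hn⟩ := eventually_atTop.1
      (hR.eventually_leastUnrefuted_eq hL hT hfind fun b => Nat.find_min hex)
    exact ⟨n, _, congrArg some (hn n le_rfl), hfind, fun j hj =>
      congrArg some ((hn j hj).trans (hn n le_rfl).symm)⟩
  · obtain rfl := Option.some.inj he
    have hlt := (hR.monotone_leastUnrefuted T (n.le_add_right k)).lt_of_ne fun h =>
      hne (congrArg some h)
    exact hR.sound (refuted_of_lt_leastUnrefuted hlt) hsub

end Enumeration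

theorem UniformlyRE.exists_index {H : ℕ → Set ℕ} (hH : UniformlyRE H) :
    ∃ t : ℕ → ℕ, Computable t ∧ ∀ i, W (t i) = H i := by
  have hpartrec : Nat.Partrec fun n => (Part.assert (n.unpair.2 ∈ H n.unpair.1)
      fun _ => Part.some ()).map fun _ => 0 :=
    Partrec.nat_iff.1 ((Partrec.comp hH Computable.unpair).map (Computable.const 0).to₂)
  obtain ⟨c, hc⟩ := Code.exists_code.1 hpartrec
  refine ⟨fun i => Encodable.encode (c.curry i), Computable.encode.comp
    (Code.primrec₂_curry.to_comp.comp (Computable.const c) Computable.id), fun i => ?_⟩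
  ext x
  simp [W, Code.eval_curry, hc, Part.assert, Part.some, Part.map]

theorem UniformlyRE.consExLearnable {H : ℕ → Set ℕ} (hH : UniformlyRE H) {C : Set (Set ℕ)}
    (hC : ConsExLearnableWrt H C) : ConsExLearnable C := by
  obtain ⟨t, ht, hW⟩ := hH.exists_index
  obtain ⟨M, hM, hex, hcons⟩ := hC
  refine ⟨fun σ => (M σ).map t, Computable.option_map hM (ht.comp Computable.snd).to₂,
    fun L hL T hT => ?_, fun L hL T hT n k e hk he hne => ?_⟩
  · obtain ⟨n, e, he, hHe, hconv⟩ := hex L hL T hT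
    exact ⟨n, t e, congrArg (Option.map t) he, by rw [hW, hHe],
      fun j hj => congrArg (Option.map t) (hconv j hj)⟩
  · obtain ⟨i, hi, rfl⟩ := Option.map_eq_some_iff.1 he
    rw [hW]
    exact hcons L hL T hT n k i hk hi fun h => hne (congrArg (Option.map t) h)

theorem ConsExLearnable.mono {C D : Set (Set ℕ)} (hCD : C ⊆ D) (hD : ConsExLearnable D) :
    ConsExLearnable C := by
  obtain ⟨M, hM, hex, hcons⟩ := hD
  exact ⟨M, hM, fun L hL => hex L (hCD hL), fun L hL => hcons L (hCD hL)⟩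

section TruncatedHypotheses

variable {η : Setoid ℕ} {Q : ℕ → ℕ × ℕ → Prop}

/-- After `s` steps of an enumeration `Q` of `η`, the number `x` still looks like the least element
of its class. -/
def StageLeader (Q : ℕ → ℕ × ℕ → Prop) (s x : ℕ) : Prop :=
  ∀ z < x, ¬ Q s (x, z)

/-- At step `t` the number `x` is put into the hypothesis `b`: it has been found equivalent to a
number below `b`, and `b` still looks like the least element of its class. -/
def StageMem (Q : ℕ → ℕ × ℕ → Prop) (t b x : ℕ) : Prop :=
  (∃ y < b, Q t (x, y)) ∧ StageLeader Q t b

/-- If `b` is the least element of its class, this is the member of the ascending family with least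
non-element `b`; otherwise the enumeration stops when this is discovered, so that `b` is left out
and membership becomes decidable from then on. -/
def hypothesis (Q : ℕ → ℕ × ℕ → Prop) (b : ℕ) : Set ℕ :=
  {x | ∃ t, StageMem Q t b x}

/-- The data `σ` rule out the hypothesis `b`: either `b` occurs in `σ`, or `b` has turned out not to
be the least element of its class, and `σ` is not consistent with the truncated hypothesis. -/
def Refutes (Q : ℕ → ℕ × ℕ → Prop) (σ : List (Option ℕ)) (b : ℕ) : Prop :=
  b ∈ content σ ∨ ¬ StageLeader Q σ.length b ∧ ¬ content σ ⊆ hypothesis Q b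

theorem stageLeader_anti (hQ : Monotone Q) {s t x : ℕ} (hst : s ≤ t) (h : StageLeader Q t x) :
    StageLeader Q s x :=
  fun z hz hs => h z hz (hQ hst _ hs)

theorem mem_hypothesis_iff_of_not_stageLeader (hQ : Monotone Q) {s b x : ℕ}
    (hb : ¬ StageLeader Q s b) : x ∈ hypothesis Q b ↔ ∃ t < s, StageMem Q t b x :=
  ⟨fun ⟨t, ht⟩ => ⟨t, not_le.1 fun hst => hb (stageLeader_anti hQ hst ht.2), ht⟩,
    fun ⟨t, _, ht⟩ => ⟨t, ht⟩⟩

theorem refutes_append (hQ : Monotone Q) {σ : List (Option ℕ)} {b : ℕ} (h : Refutes Q σ b)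
    (τ : List (Option ℕ)) : Refutes Q (σ ++ τ) b := by
  have hsub : content σ ⊆ content (σ ++ τ) := content_append σ τ ▸ Set.subset_union_left
  refine h.imp (@hsub b) fun ⟨hb, hσ⟩ => ⟨fun hb' => hb ?_, fun hστ => hσ (hsub.trans hστ)⟩
  exact stageLeader_anti hQ (by simp) hb'

theorem notMem_hypothesis (Q : ℕ → ℕ × ℕ → Prop) (b : ℕ) : b ∉ hypothesis Q b :=
  fun ⟨_, ⟨y, hy, h⟩, hb⟩ => hb y hy h

theorem not_content_subset_of_refutes {σ : List (Option ℕ)} {b : ℕ} (h : Refutes Q σ b) :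
    ¬ content σ ⊆ hypothesis Q b :=
  h.elim (fun hb hsub => notMem_hypothesis Q b (hsub hb)) And.right

section Computability

variable (hQ : PrimrecRel Q)
include hQ

theorem primrecPred_stageLeader : PrimrecPred fun q : ℕ × ℕ => StageLeader Q q.1 q.2 :=
  (primrecPred_forall_mem (Primrec.list_range.comp Primrec.snd)
    (p := fun (q : ℕ × ℕ) z => ¬ Q q.1 (q.2, z)) (hQ.comp (Primrec.fst.comp Primrec.fst)
      ((Primrec.snd.comp Primrec.fst).pair Primrec.snd)).not).of_eq fun q => by
    simp [StageLeader]

theorem primrecPred_stageMem : PrimrecPred fun q : ℕ × ℕ × ℕ => StageMem Q q.1 q.2.1 q.2.2 := by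
  have hbelow : PrimrecPred fun q : ℕ × ℕ × ℕ => ∃ y < q.2.1, Q q.1 (q.2.2, y) :=
    (primrecPred_exists_mem (p := fun (q : ℕ × ℕ × ℕ) y => Q q.1 (q.2.2, y))
      (Primrec.list_range.comp (Primrec.fst.comp Primrec.snd))
      (hQ.comp (Primrec.fst.comp Primrec.fst)
        ((Primrec.snd.comp (Primrec.snd.comp Primrec.fst)).pair Primrec.snd))).of_eq
      fun q => by simp
  exact hbelow.and ((primrecPred_stageLeader hQ).comp
    (Primrec.fst.pair (Primrec.fst.comp Primrec.snd)))

theorem uniformlyRE_hypothesis : UniformlyRE (hypothesis Q) :=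
  rePred_exists (p := fun (q : ℕ × ℕ) t => StageMem Q t q.1 q.2)
    ((primrecPred_stageMem hQ).comp (Primrec.snd.pair Primrec.fst)).computablePred.to_re

theorem computablePred_refutes (hmono : Monotone Q) :
    ComputablePred fun q : List (Option ℕ) × ℕ => Refutes Q q.1 q.2 := by
  have hσ : Primrec fun q : List (Option ℕ) × ℕ => q.1.reduceOption :=
    (Primrec.listFilterMap Primrec.id Primrec.snd.to₂).comp Primrec.fst
  have hlength : Primrec fun q : List (Option ℕ) × ℕ => q.1.length :=
    Primrec.list_length.comp Primrec.fst
  have hmem : PrimrecRel fun (q : List (Option ℕ) × ℕ) x =>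
      ∃ t ∈ List.range q.1.length, StageMem Q t q.2 x :=
    primrecPred_exists_mem (p := fun (r : (List (Option ℕ) × ℕ) × ℕ) t => StageMem Q t r.1.2 r.2)
      (Primrec.list_range.comp (hlength.comp Primrec.fst))
      ((primrecPred_stageMem hQ).comp (Primrec.snd.pair
        ((Primrec.snd.comp (Primrec.fst.comp Primrec.fst)).pair
          (Primrec.snd.comp Primrec.fst))))
  have hocc : PrimrecPred fun q : List (Option ℕ) × ℕ => ∃ x ∈ q.1.reduceOption, x = q.2 :=
    primrecPred_exists_mem hσ (Primrec.eq.comp Primrec.snd (Primrec.snd.comp Primrec.fst))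
  refine (hocc.or (((primrecPred_stageLeader hQ).comp (hlength.pair Primrec.snd)).not.and
    (primrecPred_forall_mem hσ hmem).not)).of_eq (fun q => ?_) |>.computablePred
  refine or_congr (by simp [mem_reduceOption_iff_mem_content])
    (and_congr_right fun hb => not_congr (forall_congr' fun x => ?_))
  rw [mem_reduceOption_iff_mem_content, mem_hypothesis_iff_of_not_stageLeader hmono hb]
  simp only [List.mem_range]

end Computability

section Stagewise

variable (hQ : IsStagewise (fun p : ℕ × ℕ => η p.1 p.2) Q)
include hQ

theorem exists_lt_equiv_of_mem_hypothesis {b x : ℕ} (hx : x ∈ hypothesis Q b) : ∃ y < b, η x y :=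
  let ⟨t, ⟨y, hy, h⟩, _⟩ := hx
  ⟨y, hy, (hQ.iff (x, y)).2 ⟨t, h⟩⟩

theorem stageLeader_of_isLeader {x : ℕ} (hx : IsLeader η x) (s : ℕ) : StageLeader Q s x :=
  fun z hz hs => isLeader_iff_forall_lt.1 hx z hz ((hQ.iff (x, z)).2 ⟨s, hs⟩)

theorem exists_not_stageLeader {x : ℕ} (hx : ¬ IsLeader η x) : ∃ s, ¬ StageLeader Q s x := by
  rw [isLeader_iff_forall_lt] at hx
  push Not at hx
  obtain ⟨z, hz, hxz⟩ := hx
  obtain ⟨s, hs⟩ := (hQ.iff (x, z)).1 hxz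
  exact ⟨s, fun h => h z hz hs⟩

theorem mem_hypothesis_iff_of_isLeader {b x : ℕ} (hb : IsLeader η b) :
    x ∈ hypothesis Q b ↔ ∃ y < b, η x y := by
  refine ⟨exists_lt_equiv_of_mem_hypothesis hQ, fun ⟨y, hy, hxy⟩ => ?_⟩
  obtain ⟨t, ht⟩ := (hQ.iff (x, y)).1 hxy
  exact ⟨t, ⟨y, hy, ht⟩, stageLeader_of_isLeader hQ hb t⟩

variable [Infinite (Quotient η)]

theorem hypothesis_leastRep (k : ℕ) : hypothesis Q (leastRep η k) = ascendingSet η k :=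
  Set.ext fun _ => (mem_hypothesis_iff_of_isLeader hQ (isLeader_leastRep k)).trans
    mem_ascendingSet_iff_exists_lt_leastRep.symm

theorem hypothesis_subset_ascendingSet {b k : ℕ} (hb : b < leastRep η k) :
    hypothesis Q b ⊆ ascendingSet η k := fun _ hx =>
  let ⟨y, hy, hxy⟩ := exists_lt_equiv_of_mem_hypothesis hQ hx
  mem_ascendingSet_iff_exists_lt_leastRep.2 ⟨y, hy.trans hb, hxy⟩

theorem exists_refutes {k b : ℕ} {T : ℕ → Option ℕ} (hT : IsText T (ascendingSet η k))
    (hb : ¬ ascendingSet η k ⊆ hypothesis Q b) : ∃ n, Refutes Q (initSeg T n) b := by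
  obtain ⟨x, hx, hxb⟩ := Set.not_subset.1 hb
  by_cases hleader : IsLeader η b
  · have hbk : b < leastRep η k := by
      obtain ⟨y, hy, hxy⟩ := mem_ascendingSet_iff_exists_lt_leastRep.1 hx
      exact not_le.1 fun hkb =>
        hxb ((mem_hypothesis_iff_of_isLeader hQ hleader).2 ⟨y, hy.trans_le hkb, hxy⟩)
    obtain ⟨n, hn⟩ := hT.exists_mem_content
      (mem_ascendingSet_iff_exists_lt_leastRep.2 ⟨b, hbk, η.refl b⟩)
    exact ⟨n, Or.inl hn⟩
  · obtain ⟨s, hs⟩ := exists_not_stageLeader hQ hleader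
    obtain ⟨m, hm⟩ := hT.exists_mem_content hx
    refine ⟨max s m, Or.inr ⟨fun h => hs (stageLeader_anti hQ.mono ?_ h), fun hsub => hxb ?_⟩⟩
    · exact length_initSeg T _ ▸ le_max_left s m
    · exact hsub (content_initSeg_mono T (le_max_right s m) hm)

theorem isRefutation_refutes : IsRefutation (hypothesis Q) (ascendingFamily η) (Refutes Q) where
  computable := computablePred_refutes hQ.primrec hQ.mono
  sound := not_content_subset_of_refutes
  append := refutes_append hQ.mono
  complete := by
    rintro _ T b ⟨k, rfl⟩ hT hb
    exact exists_refutes hQ hT hb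

end Stagewise

theorem consExLearnable_ascendingFamily (hη : IsPositive η) :
    ConsExLearnable (ascendingFamily η) := by
  have : Infinite (Quotient η) := hη.2
  obtain ⟨Q, hQ⟩ := exists_isStagewise hη.1
  refine (uniformlyRE_hypothesis hQ.primrec).consExLearnable
    ((isRefutation_refutes hQ).consExLearnableWrt ?_)
  rintro _ ⟨k, rfl⟩
  exact ⟨leastRep η k, hypothesis_leastRep hQ k, fun b => hypothesis_subset_ascendingSet hQ⟩

end TruncatedHypotheses

end EtaLearn
theorem theorem7p3 (η : Setoid ℕ) (hη : EtaLearn.IsPositive η) :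
    ∃ f : ℕ → ℕ, StrictMono f ∧ EtaLearn.LimitFromBelow f ∧ EtaLearn.DominatesRecursive f ∧
      ∃ C : Set (Set ℕ), C = Set.range (fun n => EtaLearn.ascendingSet η (f n + 1)) ∧
        C ⊆ EtaLearn.ascendingFamily η ∧ EtaLearn.IsEtaFamily η C ∧
        EtaLearn.ConsExLearnable C ∧ ¬ EtaLearn.ClassPreservingConsExLearnable C := by
  have : Infinite (Quotient η) := hη.2
  let f := EtaLearn.majorant EtaLearn.programValue
  have hf : StrictMono f := EtaLearn.majorant_strictMono _
  have hlim : EtaLearn.LimitFromBelow f :=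
    EtaLearn.limitFromBelow_majorant EtaLearn.limitFromBelow_programValue
  have hdom : EtaLearn.DominatesRecursive f := EtaLearn.dominatesRecursive_majorant_programValue
  have hB : StrictMono fun n => EtaLearn.ascendingSet η (f n + 1) := fun _ _ hmn =>
    EtaLearn.ascendingSet_strictMono (Nat.succ_lt_succ (hf hmn))
  have hsub : Set.range (fun n => EtaLearn.ascendingSet η (f n + 1)) ⊆
      EtaLearn.ascendingFamily η := Set.range_subset_iff.2 fun _ => Set.mem_range_self _
  exact ⟨f, hf, hlim, hdom, _, rfl, hsub, ⟨Set.forall_mem_range.2 fun n =>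
    EtaLearn.isEtaClosed_ascendingSet η (f n + 1), _,
    EtaLearn.uniformlyRE_ascendingSet_succ_comp hη.1 hlim, hB.injective, rfl⟩,
    (EtaLearn.consExLearnable_ascendingFamily hη).mono hsub,
    EtaLearn.not_classPreservingConsExLearnable_range hB hdom fun n =>
      EtaLearn.Iic_subset_ascendingSet_succ (f n)⟩
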